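/- Proposition (All the divergent non-vacuum graphs of the Abelian melonic $\phi^4$ model are melonic). Consider the Feynman graphs of the rank-$4$ quartic melonic model on $SU(2)/U(1)$. Such a graph $G$ has a finite set of interaction bubbles. Each bubble is one of the four bubbles $b_1,\dots,b_4$; the bubble $b_i$ has two black nodes $x_0,x_1$ and two white nodes $\bar x_0,\bar x_1$, for each colour $j\in\{1,2,3,4\}\setminus\{i\}$ a line of colour $j$ between $x_a$ and $\bar x_a$ ($a=0,1$), and a line of colour $i$ between $x_a$ and $\bar x_{1-a}$ ($a=0,1$). In addition, $G$ has a finite set $L(G)$ of dotted lines (propagators, colour $0$), each of which joins a black node to a white node, every node being on at most one dotted line. The nodes that are on no dotted line carry the external lines; $N(G)$ is their number, and $G$ is a vacuum graph if $N(G)=0$. For two distinct colours $c,c'\in\{0,\dots,4\}$, a (closed) face of colours $c,c'$ is a closed cycle of lines alternately of colours $c$ and $c'$. The set $F(G)$ of internal faces consists of the closed faces of colours $0,i$, $i=1,\dots,4$. With the dotted lines oriented from black to white, let $\epsilon_{ef}=1$ if $e\in L(G)$ lies on $f\in F(G)$ and $\epsilon_{ef}=0$ otherwise, and let $R(G)$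 be the rank of the matrix $(\epsilon_{ef})$. The Abelian superficial divergence degree is $$\omega(G)=-2|L(G)|+2\big(|F(G)|-R(G)\big).$$ For a connected vacuum graph $G$ and a cyclic permutation $\tau$ of all five colours, the jacket $J_\tau$ (with $J_\tau=J_{\tau^{-1}}$) has all the nodes and all the lines (of colours $0,\dots,4$) of $G$, and the faces of $G$ of colours $c,\tau(c)$ for the five colours $c$; its genus $g_{J}$ is defined by $|\mathcal F_J|-|\mathcal E_J|+|\mathcal V_J|=2-2g_J$, where $\mathcal F_J,\mathcal E_J,\mathcal V_J$ are its sets of faces, lines and nodes. The degree of $G$ is the sum of the genera of its $12$ jackets. A connected vacuum graph is melonic if its degree is zero, and a graph with external lines is melonic if it is obtained from a melonic vacuum graph by cutting (removing) dotted lines. Then every connected graph $G$ of the model with $N(G)>0$ and $\omega(G)\ge 0$ is melonic. -/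

import Mathlib

/-!
Feynman graphs of the rank-4 quartic melonic tensorial model: a field has 4 arguments (colours
`1,…,4`, here `Fin 4`), and there is one quartic interaction bubble `b_i` for every colour `i`.
-/

namespace QuarticMelonic

/-- The colours of the lines of a colored extension: `none` is the colour `0` of the dotted
(propagator) lines, `some i` are the four colours of the lines inside the bubbles. -/
abbrev Color : Type := Option (Fin 4)

/-- The nodes of a graph with set of bubbles `V`: every bubble `v` has two black nodes
`Sum.inl (v, a)` (fields) and two white nodes `Sum.inr (v, a)` (conjugate fields), `a : Bool`. -/
abbrev Node (V : Type*) : Type _ := (V × Bool) ⊕ (V × Bool)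

/-- A Feynman graph with set of interaction bubbles `V`. The bubble at `v` is `b_i` with
`i = color v`. A dotted line is a Wick contraction of a black node with a white node, every node
being contracted at most once: `w ∈ line b` says that there is a dotted line from the black node
`b` to the white node `w`. The nodes which are not contracted carry the external lines. -/
structure FeynmanGraph (V : Type*) where
  color : V → Fin 4
  line : (V × Bool) ≃. (V × Bool)

namespace FeynmanGraph

variable {V : Type*}

/-- The white node joined to a black node by the colored line of colour `i` of its bubble.
In the bubble `b_j` the black node `a` and the white node `a` form a 3-dipole (the three colours
different from `j`), and the lines of colour `j` join the two dipoles. -/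
def partner (G : FeynmanGraph V) (i : Fin 4) (b : V × Bool) : V × Bool :=
  if G.color b.1 = i then (b.1, !b.2) else b

/-- There is a line of colour `c` between the black node `b` and the white node `w`. -/
def Joins (G : FeynmanGraph V) : Color → V × Bool → V × Bool → Prop
  | none, b, w => w ∈ G.line b
  | some i, b, w => w = G.partner i b

/-- The graph on the nodes which is formed by the lines with colour in `S`. -/
def sub (G : FeynmanGraph V) (S : Set Color) : SimpleGraph (Node V) :=
  SimpleGraph.fromRel fun x y => ∃ b w, x = Sum.inl b ∧ y = Sum.inr w ∧ ∃ c ∈ S, G.Joins c b w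

def Connected (G : FeynmanGraph V) : Prop := (G.sub Set.univ).Connected

/-- The closed faces with boundary lines of colours `c` and `c'` (`c ≠ c'`): the connected
components of the graph formed by these lines at every node of which a line of either colour ends.
(Such a component is a cycle of lines alternately of colours `c` and `c'`; the other components are
open chains that end at external lines.) -/
def Face (G : FeynmanGraph V) (c c' : Color) : Type _ :=
  {C : (G.sub {c, c'}).ConnectedComponent //
    ∀ x ∈ C.supp, (∃ y, (G.sub {c}).Adj x y) ∧ ∃ y, (G.sub {c'}).Adj x y}

/-- The dotted lines, each given by its black end. -/
abbrev Line (G : FeynmanGraph V) : Type _ := {b : V × Bool // (G.line b).isSome}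

/-- The internal faces of the Feynman graph: the closed faces of colours `0` and `i`, `i ≠ 0`. -/
abbrev InternalFace (G : FeynmanGraph V) : Type _ := Σ i : Fin 4, G.Face none (some i)

/-- The number of external lines. -/
noncomputable def numExternal (G : FeynmanGraph V) : ℕ :=
  Nat.card {b : V × Bool // G.line b = none} + Nat.card {w : V × Bool // G.line.symm w = none}

open Classical in
/-- The incidence matrix between internal faces and dotted lines. All dotted lines are oriented
from black to white; each face passes through all its dotted lines in that direction (or through
all of them in the opposite one, which we exclude by the choice of its orientation), and at most
once through each of them, so that the entry is `1` or `0`. -/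
noncomputable def incidence (G : FeynmanGraph V) : Matrix G.InternalFace G.Line ℚ :=
  fun f e => if (Sum.inl e.1 : Node V) ∈ f.2.1.supp then 1 else 0

/-- The Abelian superficial divergence degree `-2 |L| + (D - 1) (|F| - R)` of a graph of the model
on `SO(D) / SO(D-1)`. For `SU(2) / U(1)`, `D = 3`. -/
noncomputable def abelianDegree [Fintype V] (D : ℕ) (G : FeynmanGraph V) : ℤ :=
  -2 * (Nat.card G.Line : ℤ) +
    ((D : ℤ) - 1) * ((Nat.card G.InternalFace : ℤ) - (G.incidence.rank : ℤ))

/-- A vacuum graph: no external lines. -/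
def IsVacuum (G : FeynmanGraph V) : Prop := ∀ b, (G.line b).isSome ∧ (G.line.symm b).isSome

/-- The set of all lines (dotted and colored) of the colored extension. -/
def ExtLine (G : FeynmanGraph V) : Type _ :=
  {l : Color × (V × Bool) × (V × Bool) // G.Joins l.1 l.2.1 l.2.2}

/-- The Euler characteristic `|F| - |E| + |V|` of the jacket of a vacuum graph that is labeled by
the 5-cycle `τ`; its faces are the faces of colours `c` and `τ c`, for `c` running through the
five colours. -/
noncomputable def jacketEulerChar (G : FeynmanGraph V) (τ : Equiv.Perm Color) : ℤ :=
  (∑ c, (Nat.card (G.Face c (τ c)) : ℤ)) - (Nat.card G.ExtLine : ℤ) + (Nat.card (Node V) : ℤ)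

/-- The genus `g` of the jacket labeled by `τ`, from `χ = 2 - 2 g`. -/
noncomputable def jacketGenus (G : FeynmanGraph V) (τ : Equiv.Perm Color) : ℚ :=
  (2 - (G.jacketEulerChar τ : ℚ)) / 2

open Classical in
/-- The degree of the colored extension of a connected vacuum graph: the sum of the genera of its
jackets. The cycles `τ` and `τ⁻¹` label the same jacket, whence the factor `1 / 2`. -/
noncomputable def degree (G : FeynmanGraph V) : ℚ :=
  (1 / 2) * ∑ τ : Equiv.Perm Color with τ.IsCycle ∧ τ.support = Finset.univ, G.jacketGenus τ

/-- `G` is obtained from `G'` by cutting some (possibly no) dotted lines. -/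
def IsCutOf (G G' : FeynmanGraph V) : Prop := G.color = G'.color ∧ G.line ≤ G'.line

/-- Melonic graphs: the connected vacuum graphs of degree zero, and the graphs that are obtained
from them by cutting dotted lines. -/
def IsMelonic (G : FeynmanGraph V) : Prop :=
  ∃ G' : FeynmanGraph V, G'.IsVacuum ∧ G'.Connected ∧ G'.degree = 0 ∧ G.IsCutOf G'

end FeynmanGraph

end QuarticMelonic

/-! Pass to the intermediate field graph: its vertices are the cycles and chains of dotted lines
("loop vertices"), and each bubble is an edge joining its two dipoles. Divergence forces this graph
to be a tree, and trees are melonic.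

Bounding |F| - R: this number is the dimension of the left kernel of the incidence matrix, i.e. of
the face labelings with sum zero on each dotted line. Such a labeling is a sum-zero vector in ℚ⁴ on
each loop vertex. It vanishes on open chains, and a bubble of colour `i` equates the `i`-th
coordinates at its ends. Starting at an open chain, each closed loop has one coordinate fixed by its
parent and one by the sum, so |F| - R is at most twice the number of closed loops
(`card_internalFace_le`). With ω ≥ 0 this gives |L| ≤ 2 · (closed loops). Counting black nodes then
yields more loop vertices than bubbles (`card_lt_of_divergent`), so the connected graph is a tree
(`tree_of_card_lt`).

Closing each chain to a cycle keeps the tree and gives a vacuum graph. Its faces can be counted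
(`card_face_inner`, `card_face_outer`), and every jacket has Euler characteristic 2
(`jacketGenus_close`). -/

namespace QuarticMelonic

namespace FeynmanGraph

variable {V : Type*}

/-! ### Loop vertices and the closing of chains. -/

/-- Two dipoles (a dipole is a black node together with the white node of the same label) are
equivalent if they lie on the same cycle or chain of dotted lines. -/
def loopSetoid (G : FeynmanGraph V) : Setoid (V × Bool) :=
  Relation.EqvGen.setoid fun x y => y ∈ G.line x

/-- The loop vertices: the vertices of the intermediate field representation, whose edges are the
bubbles. -/
abbrev LoopVertex (G : FeynmanGraph V) : Type _ := Quotient G.loopSetoid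

def loop (G : FeynmanGraph V) (x : V × Bool) : G.LoopVertex := Quotient.mk _ x

theorem loop_surjective (G : FeynmanGraph V) : Function.Surjective G.loop :=
  Quotient.mk_surjective

theorem loop_eq_of_mem {G : FeynmanGraph V} {x y : V × Bool} (h : y ∈ G.line x) :
    G.loop x = G.loop y :=
  Quotient.sound (Relation.EqvGen.rel _ _ h)

theorem eq_of_loop_eq {G : FeynmanGraph V} {α : Type*} {f : V × Bool → α}
    (hf : ∀ x y, y ∈ G.line x → f x = f y) {x y : V × Bool} (h : G.loop x = G.loop y) :
    f x = f y := by
  have h' : Relation.EqvGen (fun x y => y ∈ G.line x) x y := Quotient.exact h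
  clear h
  induction h' with
  | rel x y h => exact hf x y h
  | refl => rfl
  | symm x y _ ih => exact ih.symm
  | trans x y z _ _ ih₁ ih₂ => exact ih₁.trans ih₂

/-- A chain of dotted lines has only one end without an outgoing line. -/
theorem eq_of_loop_eq_of_line_eq_none {G : FeynmanGraph V} {x y : V × Bool}
    (hx : G.line x = none) (hy : G.line y = none) (h : G.loop x = G.loop y) : x = y := by
  let r : V × Bool → V × Bool → Prop := fun x y => y ∈ G.line x
  -- Lines are deterministic and stop at `x`, so "`x` is reached from here" is unchanged along a
  -- line.
  have key : ∀ a b, b ∈ G.line a →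
      (Relation.ReflTransGen r a x) = (Relation.ReflTransGen r b x) := by
    intro a b hab
    refine propext ⟨fun ha => ?_, fun hb => Relation.ReflTransGen.head hab hb⟩
    rcases Relation.ReflTransGen.cases_head ha with rfl | ⟨c, hc, hcx⟩
    · rw [hx] at hab; cases hab
    · have hcb : c = b := Option.mem_unique hc hab
      exact hcb ▸ hcx
  have hyx : Relation.ReflTransGen r y x :=
    (eq_of_loop_eq (f := fun a => Relation.ReflTransGen r a x) key h).mp .refl
  rcases Relation.ReflTransGen.cases_head hyx with rfl | ⟨c, hc, -⟩
  · rfl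
  · have hc' : c ∈ G.line y := hc
    rw [hy] at hc'; cases hc'

open Classical in
/-- The chains of dotted lines can be closed to cycles. -/
theorem exists_perm_extending [Finite V] (G : FeynmanGraph V) :
    ∃ σ : Equiv.Perm (V × Bool), (∀ x y, y ∈ G.line x → σ x = y) ∧
      ∀ x, G.loop (σ x) = G.loop x := by
  have key : ∀ q : G.LoopVertex, ∃ s : Equiv.Perm {x // G.loop x = q},
      ∀ x y, y.1 ∈ G.line x.1 → s x = y := by
    intro q
    -- Within one class the lines form a partial injection; on a finite set it extends to a
    -- permutation.
    let e : {x : {x // G.loop x = q} // (G.line x.1).isSome} ≃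
        {x : {x // G.loop x = q} // (G.line.symm x.1).isSome} :=
      { toFun := fun x => ⟨⟨(G.line x.1.1).get x.2,
          (loop_eq_of_mem (Option.get_mem x.2)).symm.trans x.1.2⟩,
          Option.isSome_iff_exists.2 ⟨x.1.1, G.line.mem_iff_mem.2 (Option.get_mem x.2)⟩⟩
        invFun := fun x => ⟨⟨(G.line.symm x.1.1).get x.2,
          (loop_eq_of_mem (G.line.mem_iff_mem.1 (Option.get_mem x.2))).trans x.1.2⟩,
          Option.isSome_iff_exists.2 ⟨x.1.1, G.line.mem_iff_mem.1 (Option.get_mem x.2)⟩⟩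
        left_inv := fun x => by
          ext1; ext1
          exact Option.get_of_mem _ (G.line.mem_iff_mem.2 (Option.get_mem x.2))
        right_inv := fun x => by
          ext1; ext1
          exact Option.get_of_mem _ (G.line.mem_iff_mem.1 (Option.get_mem x.2)) }
    refine ⟨e.extendSubtype, fun x y hxy => ?_⟩
    have hx : (G.line x.1).isSome := Option.isSome_iff_exists.2 ⟨_, hxy⟩
    rw [e.extendSubtype_apply_of_mem x hx]
    ext1
    exact Option.get_of_mem _ hxy
  choose s hs using key
  refine ⟨(Equiv.sigmaFiberEquiv G.loop).symm.trans
    ((Equiv.sigmaCongrRight s).trans (Equiv.sigmaFiberEquiv G.loop)), fun x y hxy => ?_,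
    fun x => (s (G.loop x) ⟨x, rfl⟩).2⟩
  exact congrArg Subtype.val (hs (G.loop x) ⟨x, rfl⟩ ⟨y, (loop_eq_of_mem hxy).symm⟩ hxy)

/-! ### Connectedness, coboundary and the tree criterion. -/

theorem eq_of_reachable {α β : Type*} {H : SimpleGraph α} {f : α → β}
    (hf : ∀ x y, H.Adj x y → f x = f y) {x y : α} (h : H.Reachable x y) : f x = f y := by
  obtain ⟨p⟩ := h
  induction p with
  | nil => rfl
  | cons h _ ih => exact (hf _ _ h).trans ih

theorem sub_adj_inl_inr {G : FeynmanGraph V} {S : Set Color} {b w : V × Bool} :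
    (G.sub S).Adj (Sum.inl b) (Sum.inr w) ↔ ∃ c ∈ S, G.Joins c b w := by
  simp only [sub, SimpleGraph.fromRel_adj, ne_eq, reduceCtorEq, not_false_eq_true, true_and]
  constructor
  · rintro (⟨b, w, h, h', hc⟩ | ⟨b, w, h, h', hc⟩)
    · cases h; cases h'; exact hc
    · cases h
  · exact fun h => Or.inl ⟨b, w, rfl, rfl, h⟩

theorem eq_of_sub_adj {G : FeynmanGraph V} {S : Set Color} {β : Type*} {f : Node V → β}
    (hf : ∀ c ∈ S, ∀ b w, G.Joins c b w → f (Sum.inl b) = f (Sum.inr w)) {x y : Node V}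
    (h : (G.sub S).Adj x y) : f x = f y := by
  obtain ⟨-, ⟨b, w, rfl, rfl, c, hc, hj⟩ | ⟨b, w, rfl, rfl, c, hc, hj⟩⟩ := h
  · exact hf c hc b w hj
  · exact (hf c hc b w hj).symm

theorem sub_adj_of_joins {G : FeynmanGraph V} {S : Set Color} {c : Color} (hc : c ∈ S)
    {b w : V × Bool} (h : G.Joins c b w) : (G.sub S).Adj (Sum.inl b) (Sum.inr w) :=
  sub_adj_inl_inr.2 ⟨c, hc, h⟩

/-- A dotted line stays in one loop vertex; a coloured line joins the nodes of a dipole or crosses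
its bubble. So agreement across bubbles propagates everywhere. -/
theorem eq_of_connected {G : FeynmanGraph V} (hG : G.Connected) {β : Type*} {h : G.LoopVertex → β}
    (hh : ∀ v, h (G.loop (v, false)) = h (G.loop (v, true))) (p q : G.LoopVertex) : h p = h q := by
  obtain ⟨x, rfl⟩ := G.loop_surjective p
  obtain ⟨y, rfl⟩ := G.loop_surjective q
  refine eq_of_reachable (f := fun z : Node V => h (G.loop (z.elim id id)))
    (fun _ _ hz => eq_of_sub_adj (f := fun z : Node V => h (G.loop (z.elim id id))) ?_ hz) (hG.preconnected (Sum.inl x) (Sum.inl y))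
  rintro (_ | i) - b w hj
  · exact congrArg h (loop_eq_of_mem hj)
  · obtain rfl : w = G.partner i b := hj
    obtain ⟨v, a⟩ := b
    unfold partner
    split_ifs
    · cases a
      · exact hh v
      · exact (hh v).symm
    · rfl

/-- The coboundary of the graph formed by the loop vertices and the bubbles. -/
def coboundary (G : FeynmanGraph V) : (G.LoopVertex → ℚ) →ₗ[ℚ] (V → ℚ) where
  toFun h v := h (G.loop (v, false)) - h (G.loop (v, true))
  map_add' h k := by ext v; simp only [Pi.add_apply]; ring
  map_smul' c h := by ext v; simp only [Pi.smul_apply, smul_eq_mul, RingHom.id_apply]; ring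

theorem coboundary_apply (G : FeynmanGraph V) (h : G.LoopVertex → ℚ) (v : V) :
    G.coboundary h v = h (G.loop (v, false)) - h (G.loop (v, true)) := rfl

instance [Finite V] (G : FeynmanGraph V) : Finite G.LoopVertex :=
  Finite.of_surjective _ G.loop_surjective

/-- By connectedness the kernel of the coboundary consists of constants, so rank-nullity loses at
most one dimension. -/
theorem card_loopVertex_le [Fintype V] {G : FeynmanGraph V} (hG : G.Connected) :
    Nat.card G.LoopVertex ≤ Module.finrank ℚ (LinearMap.range G.coboundary) + 1 := by
  have := Fintype.ofFinite G.LoopVertex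
  have h1 := LinearMap.finrank_range_add_finrank_ker G.coboundary
  have hker : LinearMap.ker G.coboundary ≤ Submodule.span ℚ {fun _ => 1} := by
    intro h hh
    have hc := eq_of_connected hG (h := h) fun v => sub_eq_zero.1 (congrFun hh v)
    obtain ⟨x⟩ := hG.nonempty
    refine Submodule.mem_span_singleton.2 ⟨h (G.loop (x.elim id id)), ?_⟩
    ext q
    simp [hc q (G.loop (x.elim id id))]
  have h2 := (Submodule.finrank_mono hker).trans (finrank_span_le_card _)
  rw [Set.toFinset_singleton, Finset.card_singleton] at h2
  rw [Module.finrank_fintype_fun_eq_card] at h1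
  rw [Nat.card_eq_fintype_card]
  omega

/-- If there are more loop vertices than bubbles, they form a tree. -/
theorem tree_of_card_lt [Fintype V] {G : FeynmanGraph V} (hG : G.Connected)
    (h : Nat.card V < Nat.card G.LoopVertex) :
    Nat.card G.LoopVertex = Nat.card V + 1 ∧ Function.Surjective G.coboundary := by
  have h1 := card_loopVertex_le hG
  have h2 := (LinearMap.range G.coboundary).finrank_le
  rw [Module.finrank_fintype_fun_eq_card, ← Nat.card_eq_fintype_card] at h2
  refine ⟨by omega, LinearMap.range_eq_top.1 (Submodule.eq_top_of_finrank_eq ?_)⟩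
  rw [Module.finrank_fintype_fun_eq_card, ← Nat.card_eq_fintype_card]
  omega

/-- The rank is the graph distance to the root; the first edge of a shortest walk leads to the
parent. -/
theorem exists_parent {G : FeynmanGraph V} (hG : G.Connected) (root : G.LoopVertex) :
    ∃ rk : G.LoopVertex → ℕ, ∀ q, q ≠ root →
      ∃ x, G.loop x = q ∧ rk (G.loop (x.1, !x.2)) < rk q := by
  let H : SimpleGraph G.LoopVertex :=
    SimpleGraph.fromRel fun p q => ∃ x, p = G.loop x ∧ q = G.loop (x.1, !x.2)
  have hadj : ∀ x, G.loop x ≠ G.loop (x.1, !x.2) → H.Adj (G.loop x) (G.loop (x.1, !x.2)) :=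
    fun x hx => ⟨hx, Or.inl ⟨x, rfl, rfl⟩⟩
  have hreach : ∀ q, H.Reachable q root := by
    intro q
    refine (eq_of_connected hG (h := fun q => H.Reachable q root) (fun v => ?_) q root).mpr .rfl
    by_cases hv : G.loop (v, false) = G.loop (v, true)
    · rw [hv]
    · have h := hadj (v, false) hv
      exact propext ⟨fun h' => h.symm.reachable.trans h', fun h' => h.reachable.trans h'⟩
  refine ⟨fun q => H.dist q root, fun q hq => ?_⟩
  obtain ⟨p, hp⟩ := (hreach q).exists_walk_length_eq_dist
  cases p with
  | nil => exact absurd rfl hq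
  | cons h p =>
    have hlt : ∀ {r s : G.LoopVertex} (p : H.Walk r root), p.length + 1 = H.dist s root →
        H.dist r root < H.dist s root := fun p hp => by
      have := SimpleGraph.dist_le p
      omega
    replace hp := hlt p hp
    obtain ⟨-, ⟨x, hx, hy⟩ | ⟨x, hx, hy⟩⟩ := h
    · exact ⟨x, hx.symm, hy ▸ hp⟩
    · refine ⟨(x.1, !x.2), hy.symm, ?_⟩
      simpa only [Bool.not_not, ← hx] using hp

/-! ### Bound on |F| - R. -/

/-- The loop vertices that are cycles. -/
def IsClosedLoop (G : FeynmanGraph V) (q : G.LoopVertex) : Prop :=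
  ∀ x, G.loop x = q → (G.line x).isSome

theorem exists_two_colors (i : Fin 4) : ∃ g : Fin 2 → Fin 4, ∀ f : Fin 4 → ℚ,
    f i = 0 → (∀ k, f (g k) = 0) → ∑ j, f j = 0 → f = 0 := by
  -- The coordinate left over is `i + 3` modulo 4, which the zero sum determines.
  refine ⟨fun k => if k = 0 then i + 1 else i + 2, fun f h0 hk hs => ?_⟩
  have h1 := hk 0
  have h2 := hk 1
  rw [Fin.sum_univ_four] at hs
  ext j
  fin_cases i <;> simp at h0 h1 h2 <;> fin_cases j <;> simp_all

/-- A space of labelings of the loop vertices by vectors with coordinate sum zero, such that the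
labels at the two ends of every bubble agree in the coordinate of its colour and that all open
chains have label zero, has at most two dimensions for every closed loop. -/
theorem finrank_labelings_le [Finite V] {G : FeynmanGraph V} (hG : G.Connected)
    {root : G.LoopVertex} (hroot : ¬ G.IsClosedLoop root)
    {M : Type*} [AddCommGroup M] [Module ℚ M] (u : M →ₗ[ℚ] (G.LoopVertex → Fin 4 → ℚ))
    (hinj : Function.Injective u) (hsum : ∀ m q, ∑ j, u m q j = 0)
    (hopen : ∀ m q, ¬ G.IsClosedLoop q → u m q = 0)
    (hedge : ∀ m x, u m (G.loop x) (G.color x.1) = u m (G.loop (x.1, !x.2)) (G.color x.1)) :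
    Module.finrank ℚ M ≤ 2 * Nat.card {q // G.IsClosedLoop q} := by
  classical
  have := Fintype.ofFinite {q // G.IsClosedLoop q}
  obtain ⟨rk, hrk⟩ := exists_parent hG root
  choose par hpar hlt using hrk
  have hne : ∀ q, G.IsClosedLoop q → q ≠ root := fun q hq h => hroot (h ▸ hq)
  choose g hg using exists_two_colors
  -- For each closed loop, keep two coordinates other than the colour of the bubble leading to its
  -- parent.
  let T : M →ₗ[ℚ] ({q // G.IsClosedLoop q} × Fin 2 → ℚ) :=
    LinearMap.pi fun p => (LinearMap.proj (g (G.color (par p.1.1 (hne _ p.1.2)).1) p.2)).comp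
      ((LinearMap.proj p.1.1).comp u)
  have hT : ∀ m p, T m p = u m p.1.1 (g (G.color (par p.1.1 (hne _ p.1.2)).1) p.2) :=
    fun _ _ => rfl
  have hTinj : Function.Injective T := by
    refine (injective_iff_map_eq_zero T).2 fun m hm => hinj ?_
    rw [map_zero]
    -- Induction outward from the root: the parent's vanishing label kills the bubble's coordinate,
    -- and `T` and the zero sum kill the rest.
    have key : ∀ n q, rk q = n → u m q = 0 := by
      intro n
      induction n using Nat.strong_induction_on with
      | _ n ih =>
        rintro q rfl
        by_cases hq : G.IsClosedLoop q
        · refine hg (G.color (par q (hne q hq)).1) _ ?_ (fun k => ?_) (hsum m q)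
          · have h1 := hedge m (par q (hne q hq))
            rw [ih _ (hlt q (hne q hq)) _ rfl, hpar q (hne q hq)] at h1
            exact h1
          · have h2 := congrFun hm (⟨q, hq⟩, k)
            rw [hT] at h2
            exact h2
        · exact hopen m q hq
    ext1 q
    exact key _ q rfl
  have h := LinearMap.finrank_le_finrank_of_injective hTinj
  rw [Module.finrank_fintype_fun_eq_card, Fintype.card_prod, Fintype.card_fin] at h
  rw [Nat.card_eq_fintype_card]
  omega

instance [Finite V] (G : FeynmanGraph V) (c c' : Color) : Finite (G.Face c c') := by
  unfold Face
  infer_instance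

open Classical in
/-- The label of the face of colours `0`, `j` through the node `z` (zero if there is none). -/
noncomputable def faceLabel (G : FeynmanGraph V) (j : Fin 4) (z : Node V) :
    (G.InternalFace → ℚ) →ₗ[ℚ] ℚ :=
  if h : ∀ x ∈ ((G.sub {none, some j}).connectedComponentMk z).supp,
      (∃ y, (G.sub {none}).Adj x y) ∧ ∃ y, (G.sub {some j}).Adj x y then
    LinearMap.proj ⟨j, ⟨(G.sub {none, some j}).connectedComponentMk z, h⟩⟩
  else 0

theorem faceLabel_of_mem {G : FeynmanGraph V} (f : G.InternalFace) {z : Node V}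
    (hz : z ∈ f.2.1.supp) : G.faceLabel f.1 z = LinearMap.proj f := by
  obtain ⟨j, C, hC⟩ := f
  obtain rfl : (G.sub {none, some j}).connectedComponentMk z = C := hz
  exact dif_pos hC

theorem faceLabel_eq_of_joins {G : FeynmanGraph V} {j : Fin 4} {c : Color}
    (hc : c ∈ ({none, some j} : Set Color)) {b w : V × Bool} (h : G.Joins c b w) :
    G.faceLabel j (Sum.inl b) = G.faceLabel j (Sum.inr w) := by
  have := SimpleGraph.ConnectedComponent.eq.2 (sub_adj_of_joins hc h).reachable
  unfold faceLabel
  rw [this]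

theorem faceLabel_eq_zero {G : FeynmanGraph V} {j : Fin 4} {z : Node V}
    (h : ¬ ∃ y, (G.sub {none}).Adj z y) : G.faceLabel j z = 0 :=
  dif_neg fun h' => h (h' z rfl).1

theorem faceLabel_inl_eq_zero {G : FeynmanGraph V} {j : Fin 4} {b : V × Bool}
    (h : G.line b = none) : G.faceLabel j (Sum.inl b) = 0 := by
  refine faceLabel_eq_zero ?_
  rintro ⟨y, -, ⟨b', w, hb, -, c, rfl, hj⟩ | ⟨b', w, -, hb, -⟩⟩
  · cases hb
    have hj : w ∈ G.line b := hj
    rw [h] at hj; cases hj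
  · cases hb

theorem faceLabel_inr_eq_zero {G : FeynmanGraph V} {j : Fin 4} {w : V × Bool}
    (h : G.line.symm w = none) : G.faceLabel j (Sum.inr w) = 0 := by
  refine faceLabel_eq_zero ?_
  rintro ⟨y, -, ⟨b', w, hb, -⟩ | ⟨b, w', -, hb, c, rfl, hj⟩⟩
  · cases hb
  · cases hb
    have hj : b ∈ G.line.symm w := G.line.mem_iff_mem.2 hj
    rw [h] at hj; cases hj

/-- On a dotted line this is the kernel equation, open faces contributing the default zero; at an
external node all four labels are zero. -/
theorem sum_faceLabel_inl [Finite V] {G : FeynmanGraph V} {l : G.InternalFace → ℚ}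
    [Fintype G.InternalFace] (hl : Matrix.mulVecLin G.incidence.transpose l = 0)
    (b : V × Bool) : ∑ j, G.faceLabel j (Sum.inl b) l = 0 := by
  classical
  by_cases hb : (G.line b).isSome
  · have h := congrFun hl ⟨b, hb⟩
    rw [Matrix.mulVecLin_apply, Matrix.mulVec, dotProduct] at h
    simp only [Pi.zero_apply, Matrix.transpose_apply, incidence, ite_mul, one_mul, zero_mul] at h
    have := fun j => Fintype.ofFinite (G.Face none (some j))
    have hsum : ∀ F : G.InternalFace → ℚ, ∑ f, F f = ∑ j, ∑ C, F ⟨j, C⟩ := fun F =>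
      (Finset.sum_congr (by ext; simp) fun _ _ => rfl).trans
        (Fintype.sum_sigma F)
    rw [← h, hsum]
    refine Finset.sum_congr rfl fun j _ => ?_
    by_cases hf : ∃ C : G.Face none (some j), (Sum.inl b : Node V) ∈ C.1.supp
    · obtain ⟨C, hC⟩ := hf
      rw [faceLabel_of_mem ⟨j, C⟩ hC, Finset.sum_eq_single C]
      · rw [if_pos hC]; rfl
      · intro D _ hD
        refine if_neg fun hD' => hD (Subtype.ext ?_)
        exact (SimpleGraph.ConnectedComponent.mem_supp_iff _ _).1 hD' ▸
          (SimpleGraph.ConnectedComponent.mem_supp_iff _ _).1 hC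
      · simp
    · rw [Finset.sum_eq_zero fun C _ => if_neg fun hC => hf ⟨C, hC⟩]
      rw [faceLabel, dif_neg]
      · rfl
      · exact fun h' => hf ⟨⟨_, h'⟩, rfl⟩
  · exact Finset.sum_eq_zero fun j _ => by
      rw [faceLabel_inl_eq_zero (by simpa using hb)]; rfl

theorem sum_faceLabel_inr [Finite V] {G : FeynmanGraph V} {l : G.InternalFace → ℚ}
    [Fintype G.InternalFace] (hl : Matrix.mulVecLin G.incidence.transpose l = 0)
    (w : V × Bool) : ∑ j, G.faceLabel j (Sum.inr w) l = 0 := by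
  cases hw : G.line.symm w with
  | none => exact Finset.sum_eq_zero fun j _ => by rw [faceLabel_inr_eq_zero hw]; rfl
  | some b =>
    have hj : G.Joins none b w := G.line.mem_iff_mem.1 hw
    rw [← sum_faceLabel_inl hl b]
    exact Finset.sum_congr rfl fun j _ => by
      rw [faceLabel_eq_of_joins (j := j) (Or.inl rfl) hj]

/-- The two nodes of a dipole carry the same labels. -/
theorem faceLabel_inl_eq_inr [Finite V] {G : FeynmanGraph V} {l : G.InternalFace → ℚ}
    [Fintype G.InternalFace] (hl : Matrix.mulVecLin G.incidence.transpose l = 0)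
    (x : V × Bool) (j : Fin 4) : G.faceLabel j (Sum.inl x) l = G.faceLabel j (Sum.inr x) l := by
  have key : ∀ j, j ≠ G.color x.1 →
      G.faceLabel j (Sum.inl x) l = G.faceLabel j (Sum.inr x) l := fun j hj => by
    rw [faceLabel_eq_of_joins (c := some j) (Or.inr rfl)
      (show G.Joins (some j) x x from (if_neg hj.symm).symm)]
  by_cases hj : j = G.color x.1
  · have h1 := sum_faceLabel_inl hl x
    have h2 := sum_faceLabel_inr hl x
    rw [← Finset.add_sum_erase _ _ (Finset.mem_univ j)] at h1 h2
    rw [Finset.sum_congr rfl fun k hk => key k (hj ▸ Finset.ne_of_mem_erase hk)] at h1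
    linarith
  · exact key j hj

/-- A left-kernel vector descends to loop vertices because its labels agree along dotted lines and
across dipoles; `finrank_labelings_le` then applies. -/
theorem card_internalFace_le [Fintype V] {G : FeynmanGraph V} (hG : G.Connected)
    {root : G.LoopVertex} (hroot : ¬ G.IsClosedLoop root) :
    Nat.card G.InternalFace ≤ G.incidence.rank + 2 * Nat.card {q // G.IsClosedLoop q} := by
  have := Fintype.ofFinite G.InternalFace
  have h := LinearMap.finrank_range_add_finrank_ker G.incidence.transpose.mulVecLin
  rw [← Matrix.rank, Matrix.rank_transpose, Module.finrank_fintype_fun_eq_card,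
    ← Nat.card_eq_fintype_card] at h
  rw [← h]
  refine Nat.add_le_add_left ?_ _
  let u : LinearMap.ker G.incidence.transpose.mulVecLin →ₗ[ℚ] (G.LoopVertex → Fin 4 → ℚ) :=
    LinearMap.pi fun q => LinearMap.pi fun j =>
      (G.faceLabel j (Sum.inl q.out)).comp (Submodule.subtype _)
  have hu : ∀ l x j, u l (G.loop x) j = G.faceLabel j (Sum.inl x) l.1 := by
    intro l x j
    refine eq_of_loop_eq (f := fun x => G.faceLabel j (Sum.inl x) l.1) (fun x y hxy => ?_)
      (x := (G.loop x).out) (y := x) (Quotient.out_eq _)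
    rw [faceLabel_inl_eq_inr l.2 y, faceLabel_eq_of_joins (c := none) (Or.inl rfl) hxy]
  refine finrank_labelings_le hG hroot u ?_ ?_ ?_ ?_
  · refine (injective_iff_map_eq_zero u).2 fun l hl => Subtype.ext (funext fun f => ?_)
    have hz : ∀ x, G.faceLabel f.1 (Sum.inl x) l.1 = 0 := fun x => by
      rw [← hu, hl]; rfl
    obtain ⟨z, hz'⟩ := f.2.1.nonempty_supp
    have h1 : G.faceLabel f.1 z l.1 = l.1 f := by rw [faceLabel_of_mem f hz']; rfl
    rw [← h1]
    rcases z with x | x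
    · exact hz x
    · rw [← faceLabel_inl_eq_inr l.2]
      exact hz x
  · intro l q
    exact sum_faceLabel_inl l.2 _
  · intro l q hq
    unfold IsClosedLoop at hq
    push Not at hq
    obtain ⟨x, rfl, hx⟩ := hq
    ext j
    rw [hu, faceLabel_inl_eq_zero (by simpa using hx)]
    rfl
  · intro l x
    rw [hu, hu, faceLabel_inl_eq_inr l.2 (x.1, !x.2), faceLabel_eq_of_joins
      (c := some (G.color x.1)) (Or.inr rfl) (show G.Joins _ x (x.1, !x.2) from (if_pos rfl).symm)]

/-! ### Consequence of divergence. -/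

/-- A divergent graph has more loop vertices than bubbles. -/
theorem card_lt_of_divergent [Fintype V] {G : FeynmanGraph V} (hG : G.Connected)
    (hext : ∃ b, G.line b = none) (hdiv : 0 ≤ G.abelianDegree 3) :
    Nat.card V < Nat.card G.LoopVertex := by
  classical
  obtain ⟨b, hb⟩ := hext
  have hopen : ∀ x, G.line x = none → ¬ G.IsClosedLoop (G.loop x) := fun x hx h => by
    have := h x rfl
    rw [hx] at this
    exact absurd this (by simp)
  have h1 := card_internalFace_le hG (hopen b hb)
  have h2 : Nat.card G.Line ≤ 2 * Nat.card {q // G.IsClosedLoop q} := by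
    unfold abelianDegree at hdiv
    push_cast at hdiv
    omega
  -- Distinct uncontracted black nodes end distinct open chains.
  have h3 : Nat.card {x // ¬ (G.line x).isSome} ≤ Nat.card {q // ¬ G.IsClosedLoop q} := by
    refine Nat.card_le_card_of_injective
      (fun x => ⟨G.loop x.1, hopen x.1 (by simpa using x.2)⟩) fun x y hxy => Subtype.ext ?_
    exact eq_of_loop_eq_of_line_eq_none (by simpa using x.2) (by simpa using y.2)
      (congrArg Subtype.val hxy)
  have h4 : Nat.card {x // ¬ (G.line x).isSome} ≠ 0 := by
    have : Nonempty {x // ¬ (G.line x).isSome} := ⟨⟨b, by simp [hb]⟩⟩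
    exact Nat.card_pos.ne'
  have h5 := Nat.card_congr (Equiv.sumCompl fun x => (G.line x).isSome = true)
  have h6 := Nat.card_congr (Equiv.sumCompl G.IsClosedLoop)
  rw [Nat.card_sum] at h5 h6
  rw [Nat.card_prod, Nat.card_eq_fintype_card (α := Bool), Fintype.card_bool] at h5
  change Nat.card {x // (G.line x).isSome = true} ≤ _ at h2
  -- With m > 0 uncontracted black nodes, 2|V| = |L| + m, while the loop vertices number at least
  -- |L|/2 + m = |V| + m/2.
  omega

/-! ### Face counts of the closed graph. -/

/-- The vacuum graph with the bubbles of `G` and the dotted lines given by a permutation. -/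
def close (G : FeynmanGraph V) (σ : Equiv.Perm (V × Bool)) : FeynmanGraph V :=
  ⟨G.color, σ.toPEquiv⟩

theorem joins_close_none {G : FeynmanGraph V} {σ : Equiv.Perm (V × Bool)} {b w : V × Bool} :
    (G.close σ).Joins none b w ↔ σ b = w :=
  Option.some_inj

theorem partner_partner (G : FeynmanGraph V) (i : Fin 4) (b : V × Bool) :
    G.partner i (G.partner i b) = b := by
  unfold partner
  split_ifs <;> simp

/-- The dipole contracted with a dipole along a colour. -/
theorem exists_perm_joins (G : FeynmanGraph V) (σ : Equiv.Perm (V × Bool)) (c : Color) :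
    ∃ s : Equiv.Perm (V × Bool), ∀ b w, (G.close σ).Joins c b w ↔ s b = w := by
  rcases c with _ | i
  · exact ⟨σ, fun b w => joins_close_none⟩
  · exact ⟨⟨G.partner i, G.partner i, G.partner_partner i, G.partner_partner i⟩,
      fun b w => eq_comm⟩

theorem exists_adj_close (G : FeynmanGraph V) (σ : Equiv.Perm (V × Bool)) (c : Color)
    (x : Node V) : ∃ y, ((G.close σ).sub {c}).Adj x y := by
  obtain ⟨s, hs⟩ := G.exists_perm_joins σ c
  rcases x with b | w
  · exact ⟨Sum.inr (s b), sub_adj_of_joins (Set.mem_singleton c) ((hs _ _).2 rfl)⟩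
  · exact ⟨Sum.inl (s.symm w),
      (sub_adj_of_joins (Set.mem_singleton c) ((hs _ _).2 (s.apply_symm_apply w))).symm⟩

theorem card_face_close (G : FeynmanGraph V) (σ : Equiv.Perm (V × Bool)) (c c' : Color) :
    Nat.card ((G.close σ).Face c c') =
      Nat.card ((G.close σ).sub {c, c'}).ConnectedComponent :=
  Nat.card_congr (Equiv.subtypeUnivEquiv fun _ x _ =>
    ⟨G.exists_adj_close σ c x, G.exists_adj_close σ c' x⟩)

theorem card_face_close_comm (G : FeynmanGraph V) (σ : Equiv.Perm (V × Bool)) (c c' : Color) :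
    Nat.card ((G.close σ).Face c c') = Nat.card ((G.close σ).Face c' c) := by
  rw [card_face_close, card_face_close, Set.pair_comm]

theorem card_extLine_close [Finite V] (G : FeynmanGraph V) (σ : Equiv.Perm (V × Bool)) :
    Nat.card (G.close σ).ExtLine = 10 * Nat.card V := by
  choose s hs using G.exists_perm_joins σ
  let e : (G.close σ).ExtLine ≃ Color × (V × Bool) :=
    { toFun := fun l => (l.1.1, l.1.2.1)
      invFun := fun p => ⟨(p.1, p.2, s p.1 p.2), (hs _ _ _).2 rfl⟩
      left_inv := fun ⟨⟨c, b, w⟩, h⟩ => by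
        obtain rfl : s c b = w := (hs _ _ _).1 h
        rfl
      right_inv := fun _ => rfl }
  rw [Nat.card_congr e, Nat.card_prod, Nat.card_prod, Nat.card_eq_fintype_card (α := Color),
    Nat.card_eq_fintype_card (α := Bool), Fintype.card_option, Fintype.card_fin, Fintype.card_bool]
  omega

/-- The number of bubbles of a given colour. -/
noncomputable def numColor (G : FeynmanGraph V) (i : Fin 4) : ℕ := Nat.card {v // G.color v = i}

theorem sum_numColor [Finite V] (G : FeynmanGraph V) : ∑ i, G.numColor i = Nat.card V := by
  have := Fintype.ofFinite V
  rw [← Nat.card_congr (Equiv.sigmaFiberEquiv G.color), Nat.card_sigma]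
  rfl

theorem connectedComponentMk_inl_eq {G : FeynmanGraph V} {S : Set Color} {c : Color} (hc : c ∈ S)
    {b w : V × Bool} (h : G.Joins c b w) :
    (G.sub S).connectedComponentMk (Sum.inl b) = (G.sub S).connectedComponentMk (Sum.inr w) :=
  SimpleGraph.ConnectedComponent.eq.2 (sub_adj_of_joins hc h).reachable

/-- Faces of two nonzero colours stay inside a bubble: one four-node cycle if its colour is `i` or
`j`, otherwise one face per dipole. -/
theorem card_face_inner [Finite V] (G : FeynmanGraph V) (σ : Equiv.Perm (V × Bool))
    {i j : Fin 4} (hij : i ≠ j) :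
    Nat.card ((G.close σ).Face (some i) (some j)) + G.numColor i + G.numColor j =
      2 * Nat.card V := by
  classical
  rw [card_face_close]
  set H := (G.close σ).sub {some i, some j}
  have hi : ∀ b, H.connectedComponentMk (Sum.inl b) =
      H.connectedComponentMk (Sum.inr (G.partner i b)) := fun b =>
    connectedComponentMk_inl_eq (c := some i) (by simp) rfl
  have hj : ∀ b, H.connectedComponentMk (Sum.inl b) =
      H.connectedComponentMk (Sum.inr (G.partner j b)) := fun b =>
    connectedComponentMk_inl_eq (c := some j) (by simp) rfl
  let P : V → Prop := fun v => G.color v = i ∨ G.color v = j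
  have hdip : ∀ b, H.connectedComponentMk (Sum.inl b) = H.connectedComponentMk (Sum.inr b) := by
    intro b
    by_cases h : G.color b.1 = i
    · rw [hj, partner, if_neg fun h' => hij (h.symm.trans h')]
    · rw [hi, partner, if_neg h]
  have hflip : ∀ b, P b.1 →
      H.connectedComponentMk (Sum.inl b) = H.connectedComponentMk (Sum.inl (b.1, !b.2)) := by
    rintro b (h | h)
    · rw [hdip (b.1, !b.2), hi b, partner, if_pos h]
    · rw [hdip (b.1, !b.2), hj b, partner, if_pos h]
  -- Canonical representative of a face: the dipole labelled `false` when the face fills the bubble.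
  let r : V × Bool → V × Bool := fun x => if P x.1 then (x.1, false) else x
  have hr : ∀ x, H.connectedComponentMk (Sum.inl (r x)) = H.connectedComponentMk (Sum.inl x) := by
    rintro ⟨v, a⟩
    by_cases h : P v
    · simp only [r, if_pos h]
      cases a
      · rfl
      · exact hflip (v, false) h
    · simp only [r, if_neg h]
  have hadj : ∀ x y : Node V, H.Adj x y → r (x.elim id id) = r (y.elim id id) := by
    refine fun x y => eq_of_sub_adj (f := fun z : Node V => r (z.elim id id)) ?_
    have hp : ∀ k, (k = i ∨ k = j) → ∀ b, r b = r (G.partner k b) := by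
      intro k hk b
      unfold partner
      split_ifs with h
      · have : P b.1 := by rwa [← h] at hk
        simp only [r, if_pos this]
      · rfl
    rintro c (rfl | rfl) b w h
    · obtain rfl : w = G.partner i b := h
      exact hp i (Or.inl rfl) b
    · obtain rfl : w = G.partner j b := h
      exact hp j (Or.inr rfl) b
  let e : H.ConnectedComponent ≃ {x : V × Bool // P x.1 → x.2 = false} :=
    { toFun := SimpleGraph.ConnectedComponent.lift
        (fun z => ⟨r (z.elim id id), by
          by_cases h : P (z.elim id id : V × Bool).1
          · simp only [r, if_pos h]; exact fun _ => trivial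
          · simp only [r, if_neg h]; exact fun h' => absurd h' h⟩)
        (fun x y p _ => Subtype.ext (eq_of_reachable
          (f := fun z : Node V => r (z.elim id id)) hadj p.reachable))
      invFun := fun x => H.connectedComponentMk (Sum.inl x.1)
      left_inv := by
        refine SimpleGraph.ConnectedComponent.ind ?_
        rintro (x | x)
        · exact hr x
        · exact (hr x).trans (hdip x)
      right_inv := by
        rintro ⟨⟨v, a⟩, h⟩
        refine Subtype.ext ?_
        change r (v, a) = (v, a)
        by_cases hv : P v
        · obtain rfl : a = false := h hv
          simp only [r, if_pos hv]
        · simp only [r, if_neg hv] }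
  have hcompl := Nat.card_congr (Equiv.sumCompl fun x : V × Bool => P x.1 → x.2 = false)
  let e' : {x : V × Bool // ¬ (P x.1 → x.2 = false)} ≃
      {v // G.color v = i} ⊕ {v // G.color v = j} :=
    Equiv.trans
      { toFun := fun x => (⟨x.1.1, (Classical.not_imp.1 x.2).1⟩ : {v // P v})
        invFun := fun v => ⟨(v.1, true), fun h => by simpa using h v.2⟩
        left_inv := fun ⟨⟨v, a⟩, h⟩ => by
          have ha : a = true := by simpa using (Classical.not_imp.1 h).2
          simp [ha]
        right_inv := fun _ => rfl }
      (subtypeOrEquiv _ _ (Pi.disjoint_iff.2 fun v => by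
        rw [Prop.disjoint_iff]
        rintro ⟨h, h'⟩
        exact hij (h.symm.trans h')))
  rw [Nat.card_sum, Nat.card_congr e', Nat.card_sum, Nat.card_prod,
    Nat.card_eq_fintype_card (α := Bool), Fintype.card_bool] at hcompl
  rw [Nat.card_congr e]
  unfold numColor
  omega

/-- If the loop vertices and the bubbles form a tree, a function which is invariant along the faces
of colours `0`, `i` takes the same value at the two nodes of each dipole. -/
theorem eq_of_face_invariant [Finite V] {G : FeynmanGraph V}
    (hsurj : Function.Surjective G.coboundary)
    {σ : Equiv.Perm (V × Bool)} (hloop : ∀ x, G.loop (σ x) = G.loop x) {i : Fin 4}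
    {f g : V × Bool → ℚ} (hσ : ∀ x, f x = g (σ x)) (hi : ∀ x, f x = g (G.partner i x))
    (x : V × Bool) : f x = g x := by
  classical
  have := Fintype.ofFinite V
  by_cases hx : G.color x.1 = i
  swap
  · rw [hi, partner, if_neg hx]
  obtain ⟨v, a⟩ := x
  -- A potential jumping only across `v`, as for the two sides of a tree edge. Invariance under `σ`
  -- makes the total weighted difference vanish, while summing over bubbles leaves only the term of
  -- `v`.
  obtain ⟨h, hh⟩ := hsurj (Pi.single v 1)
  have h0 : ∑ x, h (G.loop x) * (f x - g x) = 0 := by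
    simp only [mul_sub, Finset.sum_sub_distrib]
    rw [sub_eq_zero, ← Equiv.sum_comp σ fun x => h (G.loop x) * g x]
    simp only [hloop, ← hσ]
  have hw : ∀ w, ∑ a, h (G.loop (w, a)) * (f (w, a) - g (w, a)) =
      G.coboundary h w * (f (w, false) - g (w, false)) := by
    intro w
    have h1 := hi (w, false)
    have h2 := hi (w, true)
    rw [Fintype.sum_bool, coboundary_apply]
    unfold partner at h1 h2
    split_ifs at h1 h2
    · simp only [Bool.not_true, Bool.not_false] at h1 h2
      rw [h1, h2]; ring
    · rw [h1, h2]; ring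
  rw [Fintype.sum_prod_type, Finset.sum_congr rfl fun w _ => hw w, hh,
    Finset.sum_eq_single v (fun w _ hw => by rw [Pi.single_eq_of_ne hw, zero_mul]) (by simp),
    Pi.single_eq_same, one_mul, sub_eq_zero] at h0
  cases a
  · exact h0
  · have h1 := hi (v, false)
    have h2 := hi (v, true)
    simp only [partner, if_pos hx, Bool.not_true, Bool.not_false] at h1 h2
    rw [h2, ← h0, h1]

/-- Faces of colours `0`, `i` correspond to the components of the forest whose edges are the
colour-`i` bubbles. The count is linear algebra: functions on faces match functions on loop vertices
constant across these bubbles. -/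
theorem card_face_outer [Finite V] {G : FeynmanGraph V}
    (hsurj : Function.Surjective G.coboundary) {σ : Equiv.Perm (V × Bool)}
    (hext : ∀ x y, y ∈ G.line x → σ x = y) (hloop : ∀ x, G.loop (σ x) = G.loop x) (i : Fin 4) :
    Nat.card ((G.close σ).Face none (some i)) + G.numColor i = Nat.card G.LoopVertex := by
  classical
  have := Fintype.ofFinite V
  have := Fintype.ofFinite G.LoopVertex
  rw [card_face_close]
  set H := (G.close σ).sub {none, some i}
  have := Fintype.ofFinite H.ConnectedComponent
  have hnone : ∀ b, H.connectedComponentMk (Sum.inl b) = H.connectedComponentMk (Sum.inr (σ b)) :=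
    fun b => connectedComponentMk_inl_eq (c := none) (by simp) (joins_close_none.2 rfl)
  have hsome : ∀ b, H.connectedComponentMk (Sum.inl b) =
      H.connectedComponentMk (Sum.inr (G.partner i b)) := fun b =>
    connectedComponentMk_inl_eq (c := some i) (by simp) rfl
  let D : (G.LoopVertex → ℚ) →ₗ[ℚ] ({v // G.color v = i} → ℚ) :=
    (LinearMap.funLeft ℚ ℚ Subtype.val).comp G.coboundary
  have hD : ∀ h v, D h v = h (G.loop (v.1, false)) - h (G.loop (v.1, true)) := fun _ _ => rfl
  have hDsurj : Function.Surjective D :=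
    (LinearMap.funLeft_surjective_of_injective ℚ ℚ _ Subtype.val_injective).comp hsurj
  have hrank := LinearMap.finrank_range_add_finrank_ker D
  rw [LinearMap.range_eq_top.2 hDsurj, finrank_top, Module.finrank_fintype_fun_eq_card,
    Module.finrank_fintype_fun_eq_card, ← Nat.card_eq_fintype_card,
    ← Nat.card_eq_fintype_card] at hrank
  have hinv : ∀ h ∈ LinearMap.ker D, ∀ x, h (G.loop (G.partner i x)) = h (G.loop x) := by
    rintro h hh ⟨v, a⟩
    unfold partner
    split_ifs with hv
    · have h1 := sub_eq_zero.1 ((hD h ⟨v, hv⟩).symm.trans (congrFun hh ⟨v, hv⟩))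
      cases a
      · exact h1.symm
      · exact h1
    · rfl
  let T : (H.ConnectedComponent → ℚ) →ₗ[ℚ] (V × Bool → ℚ) :=
    LinearMap.funLeft ℚ ℚ fun x => H.connectedComponentMk (Sum.inl x)
  let U : (G.LoopVertex → ℚ) →ₗ[ℚ] (V × Bool → ℚ) := LinearMap.funLeft ℚ ℚ G.loop
  have hTinj : Function.Injective T := by
    refine LinearMap.funLeft_injective_of_surjective ℚ ℚ _ ?_
    refine SimpleGraph.ConnectedComponent.ind ?_
    rintro (x | x)
    · exact ⟨x, rfl⟩
    · exact ⟨σ.symm x, (hnone _).trans (by rw [σ.apply_symm_apply])⟩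
  have hUinj : Function.Injective U :=
    LinearMap.funLeft_injective_of_surjective ℚ ℚ _ G.loop_surjective
  -- Both function spaces are compared after pulling back to black nodes; `eq_of_face_invariant`
  -- makes a face function descend to loop vertices.
  have hrange : LinearMap.range T = (LinearMap.ker D).map U := by
    ext f
    constructor
    · rintro ⟨φ, rfl⟩
      have hfg : ∀ x, T φ x = φ (H.connectedComponentMk (Sum.inr x)) :=
        eq_of_face_invariant (i := i) hsurj hloop (fun x => congrArg φ (hnone x))
          (fun x => congrArg φ (hsome x))
      refine ⟨fun q => T φ q.out, ?_, ?_⟩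
      all_goals
        have hl : ∀ x, T φ (G.loop x).out = T φ x := fun x =>
          eq_of_loop_eq (fun x y hxy => by
            rw [hfg y, ← hext x y hxy]
            exact congrArg φ (hnone x)) (Quotient.out_eq _)
      · ext v
        rw [hD, hl, hl, hfg (v.1, true)]
        have h1 : G.partner i (v.1, false) = (v.1, true) := if_pos v.2
        exact sub_eq_zero.2 ((congrArg φ (hsome _)).trans (by rw [h1]))
      · ext x
        exact hl x
    · rintro ⟨h, hh, rfl⟩
      refine ⟨SimpleGraph.ConnectedComponent.lift (fun z => h (G.loop (z.elim id id)))
        (fun x y p _ => eq_of_reachable (f := fun z : Node V => h (G.loop (z.elim id id)))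
          (fun _ _ hz => eq_of_sub_adj (f := fun z : Node V => h (G.loop (z.elim id id)))
            ?_ hz) p.reachable), rfl⟩
      rintro c (rfl | rfl) b w hj
      · obtain rfl := joins_close_none.1 hj
        exact congrArg h (hloop b).symm
      · obtain rfl : w = G.partner i b := hj
        exact (hinv h hh b).symm
  have h1 := LinearMap.finrank_range_of_inj hTinj
  rw [hrange, ← (Submodule.equivMapOfInjective U hUinj _).finrank_eq, Module.finrank_fintype_fun_eq_card,
    ← Nat.card_eq_fintype_card] at h1
  unfold numColor
  omega

/-! ### Jackets and conclusion. -/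

/-- If the loop vertices and the bubbles form a tree, all jackets are spheres. -/
theorem jacketGenus_close [Finite V] {G : FeynmanGraph V}
    (hcard : Nat.card G.LoopVertex = Nat.card V + 1)
    (hsurj : Function.Surjective G.coboundary) {σ : Equiv.Perm (V × Bool)}
    (hext : ∀ x y, y ∈ G.line x → σ x = y) (hloop : ∀ x, G.loop (σ x) = G.loop x)
    {τ : Equiv.Perm Color} (hτ : ∀ c, τ c ≠ c) : (G.close σ).jacketGenus τ = 0 := by
  -- Weight |V| - 1 for colour `0` puts both face counts in the form 2|V| - ν(c) - ν(c'), so the sum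
  -- over any τ without fixed points is 10|V| - 2(2|V| - 1).
  let ν : Color → ℤ := fun c => c.elim ((Nat.card V : ℤ) - 1) fun i => G.numColor i
  have hν : ∑ c, ν c = 2 * (Nat.card V : ℤ) - 1 := by
    have := G.sum_numColor
    rw [Fintype.sum_option]
    simp only [ν, Option.elim]
    rw [← Nat.cast_sum, this]
    ring
  have hface : ∀ c c', c' ≠ c →
      (Nat.card ((G.close σ).Face c c') : ℤ) = 2 * (Nat.card V : ℤ) - ν c - ν c' := by
    rintro (_ | i) (_ | j) hne
    · exact absurd rfl hne
    · have := card_face_outer hsurj hext hloop j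
      simp only [ν, Option.elim]
      omega
    · rw [card_face_close_comm]
      have := card_face_outer hsurj hext hloop i
      simp only [ν, Option.elim]
      omega
    · have := G.card_face_inner σ (i := i) (j := j) fun h => hne (h ▸ rfl)
      simp only [ν, Option.elim]
      omega
  have hsum : ∑ c, (Nat.card ((G.close σ).Face c (τ c)) : ℤ) = 6 * (Nat.card V : ℤ) + 2 := by
    rw [Finset.sum_congr rfl fun c _ => hface c (τ c) (hτ c), Finset.sum_sub_distrib,
      Finset.sum_sub_distrib, Equiv.sum_comp τ ν, hν, Finset.sum_const, Finset.card_univ,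
      Fintype.card_option, Fintype.card_fin]
    simp only [nsmul_eq_mul]
    push_cast
    ring
  have hnode : Nat.card (Node V) = 4 * Nat.card V := by
    rw [Nat.card_sum, Nat.card_prod, Nat.card_eq_fintype_card (α := Bool), Fintype.card_bool]
    omega
  have hχ : (G.close σ).jacketEulerChar τ = 2 := by
    rw [jacketEulerChar, hsum, card_extLine_close, hnode]
    push_cast
    ring
  rw [jacketGenus, hχ]
  norm_num

theorem isMelonic_of_divergent [Fintype V] (G : FeynmanGraph V)
    (hconn : G.Connected) (hext : 0 < G.numExternal) (hdiv : 0 ≤ G.abelianDegree 3) :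
    G.IsMelonic := by
  obtain ⟨σ, hσ, hloop⟩ := G.exists_perm_extending
  have hle : G.line ≤ (G.close σ).line := fun x y hxy => congrArg some (hσ x y hxy)
  -- External nodes may be counted on the white side, but if every black node is contracted, the
  -- line map is the permutation `σ` and no white node is left over.
  have hnone : ∃ b, G.line b = none := by
    by_contra! h
    have hline : ∀ b, σ b ∈ G.line b := fun b => by
      obtain ⟨w, hw⟩ := Option.ne_none_iff_exists'.1 (h b)
      rw [hσ b w hw]; exact hw
    have h1 : IsEmpty {b // G.line b = none} := ⟨fun b => h b.1 b.2⟩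
    have h2 : IsEmpty {w // G.line.symm w = none} := ⟨fun w => by
      have := G.line.mem_iff_mem.2 (hline (σ.symm w.1))
      rw [σ.apply_symm_apply, w.2] at this
      cases this⟩
    rw [numExternal, Nat.card_of_isEmpty, Nat.card_of_isEmpty] at hext
    exact absurd hext (by simp)
  obtain ⟨hcard, hsurj⟩ := tree_of_card_lt hconn (card_lt_of_divergent hconn hnone hdiv)
  refine ⟨G.close σ, fun b => ⟨rfl, rfl⟩, hconn.mono ?_, ?_, rfl, hle⟩
  · rintro x y ⟨hne, h⟩
    have hjoin : ∀ c b w, G.Joins c b w → (G.close σ).Joins c b w := by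
      rintro (_ | i) b w h
      · exact hle b w h
      · exact h
    refine ⟨hne, h.imp ?_ ?_⟩ <;>
    · rintro ⟨b, w, hb, hw, c, hc, hj⟩
      exact ⟨b, w, hb, hw, c, hc, hjoin c b w hj⟩
  · classical
    unfold degree
    refine mul_eq_zero_of_right _ (Finset.sum_eq_zero fun τ hτ => ?_)
    rw [Finset.mem_filter] at hτ
    refine jacketGenus_close hcard hsurj hσ hloop fun c => ?_
    rw [← Equiv.Perm.mem_support, hτ.2.2]
    exact Finset.mem_univ c

end FeynmanGraph

end QuarticMelonic

theorem mainTheorem5 {V : Type*} [Fintype V] (G : QuarticMelonic.FeynmanGraph V)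
    (hconn : G.Connected) (hext : 0 < G.numExternal) (hdiv : 0 ≤ G.abelianDegree 3) :
    G.IsMelonic :=
  G.isMelonic_of_divergent hconn hext hdiv
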